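/- Let $\Bbbk$ be a field and let $B$ be a $\Bbbk$-bialgebra with comultiplication $\Delta(b)=b_1\otimes b_2$ and counit $\varepsilon$. Suppose that $B$ is right perfect as a ring, i.e. that $B$ satisfies the descending chain condition on principal left ideals. Put $B^+=\ker\varepsilon$ and let $$B\oslash B=\frac{B\otimes B}{(B\otimes B)B^+},\qquad (x\otimes y)\cdot b=xb_1\otimes yb_2,$$ be the quotient of $B\otimes B$ by the subspace $(B\otimes B)B^+$ spanned by the elements $t\cdot b$ with $t\in B\otimes B$ and $b\in B^+$; write $x\oslash y$ for the class of $x\otimes y$. Let $$B\boxslash B=\Big\{\textstyle\sum_i x^i\otimes y_i\in B\otimes B \;:\; \sum_i x^i_1\otimes y_{i1}\otimes x^i_2y_{i2}=\sum_i x^i\otimes y_i\otimes 1\Big\}$$ be the subspace of coinvariants of $B\otimes B$ under the diagonal right $B$-coaction. Then the map $i_B\colon B\to B\oslash B$, $b\mapsto b\oslash 1$, is surjective, and the map $p_B\colon B\boxslash B\to B$, $\sum_i x^i\otimes y_i\mapsto \sum_i x^i\varepsilon(y_i)$, is injective. -/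

import Mathlib

open scoped TensorProduct

/-- A ring `R` is right perfect: `R` satisfies the descending chain condition on principal
left ideals (there is no mistake in the change of side). For a noncommutative ring, Mathlib's
`Ideal R` is the type of left ideals, so that `Ideal.span {a}` is the left ideal `R a`. -/
def IsRightPerfect (R : Type*) [Ring R] : Prop :=
  ∀ a : ℕ → R, (∀ n, Ideal.span {a (n + 1)} ≤ Ideal.span {a n}) →
    ∃ n, ∀ m, n ≤ m → Ideal.span {a m} = Ideal.span {a n}

noncomputable section

namespace BialgebraMaps

variable (K B : Type*) [Field K] [Ring B] [Bialgebra K B]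

/-- The subspace `(B ⊗ B) B⁺` of `B ⊗ B`, where `B⁺ = ker ε` and `B` acts diagonally on the
right of `B ⊗ B`: `(x ⊗ y) · b = x b₁ ⊗ y b₂`, that is, `t · b = t * Δ b`. -/
def augSubmodule : Submodule K (B ⊗[K] B) :=
  Submodule.span K
    {z | ∃ (t : B ⊗[K] B) (b : B), Coalgebra.counit (R := K) b = 0 ∧
      z = t * Coalgebra.comul (R := K) b}

/-- The quotient `B ⊘ B = (B ⊗ B) / (B ⊗ B) B⁺`. -/
abbrev Oslash : Type _ := (B ⊗[K] B) ⧸ augSubmodule K B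

/-- The canonical map `i_B : B → B ⊘ B`, `b ↦ b ⊘ 1`. -/
def iMap : B →ₗ[K] Oslash K B :=
  (augSubmodule K B).mkQ ∘ₗ (TensorProduct.mk K B B).flip 1

/-- The diagonal right coaction `B ⊗ B → (B ⊗ B) ⊗ B`,
`x ⊗ y ↦ (x₁ ⊗ y₁) ⊗ x₂ y₂`. -/
def diagCoaction : B ⊗[K] B →ₗ[K] (B ⊗[K] B) ⊗[K] B :=
  TensorProduct.map LinearMap.id (LinearMap.mul' K B) ∘ₗ
    (TensorProduct.tensorTensorTensorComm K B B B B).toLinearMap ∘ₗ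
      TensorProduct.map Coalgebra.comul Coalgebra.comul

/-- The subspace `B ⊠ B = (B ⊗ B)^{co B}` of the `t` in `B ⊗ B` whose image under the diagonal
right coaction is `t ⊗ 1`. -/
def boxSubmodule : Submodule K (B ⊗[K] B) :=
  LinearMap.eqLocus (diagCoaction K B) ((TensorProduct.mk K (B ⊗[K] B) B).flip 1)

/-- The canonical map `p_B : B ⊠ B → B`, `∑ xⁱ ⊗ yᵢ ↦ ∑ xⁱ ε(yᵢ)`. -/
def pMap : boxSubmodule K B →ₗ[K] B :=
  ((TensorProduct.rid K B).toLinearMap ∘ₗ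
    TensorProduct.map LinearMap.id (Coalgebra.counit (R := K) (A := B))).domRestrict
      (boxSubmodule K B)

end BialgebraMaps

end

/-! Both claims reduce to one fact about a square matrix `G` over a right perfect ring: if vectors
in a left module satisfy `G v_{k+1} = v_k` and `v_0 = 0`, then `v_1 = 0`. By Björk's theorem the row
spaces of the powers of `G` stabilise, so `G^n = Z G^(n+1)` and `v_1 = G^n v_{n+1} = Z G^(n+1)
v_{n+1} = Z v_0 = 0`. In both cases `G` is the coefficient matrix of a finite-dimensional coideal,
and `v_k` comes from the reversed convolution power `b ↦ bₖ ⋯ b₁`, which is `ε` at `k = 0` and the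
identity at `k = 1`; it plays the part of a missing antipode. For `i_B`, `v_k` is the class of `1 ⊗
bₖ ⋯ b₁` modulo `B ⊗ 1 + (B ⊗ B)B⁺`. For `p_B`, the power is applied to the right legs of a
coinvariant tensor killed by `p_B`. -/

section Perfect

/-! ### Björk's theorem and matrices over right perfect rings. -/

variable {R M : Type*} [Ring R] [AddCommGroup M] [Module R M]

open Submodule

/-- Over a right perfect ring, a descending chain of cyclic left submodules stops. -/
theorem IsRightPerfect.exists_mem_span_succ (hR : IsRightPerfect R) (x : ℕ → M)
    (hx : ∀ n, x (n + 1) ∈ span R {x n}) : ∃ n, x n ∈ span R {x (n + 1)} := by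
  simp only [mem_span_singleton] at hx
  choose r hr using hx
  obtain ⟨a, ha0, ha⟩ : ∃ a : ℕ → R, a 0 = 1 ∧ ∀ n, a (n + 1) = r n * a n :=
    ⟨fun n => Nat.rec 1 (fun k y => r k * y) n, rfl, fun _ => rfl⟩
  have hxa : ∀ n, x n = a n • x 0 := by
    intro n
    induction n with
    | zero => simp [ha0]
    | succ n ih => rw [ha, mul_smul, ← ih, hr]
  obtain ⟨n, hn⟩ := hR a fun n => by
    rw [Ideal.span_singleton_le_iff_mem, Ideal.mem_span_singleton', ha]
    exact ⟨r n, rfl⟩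
  have h1 : a n ∈ Ideal.span {a (n + 1)} := by
    rw [hn (n + 1) n.le_succ]
    exact Ideal.mem_span_singleton_self _
  obtain ⟨z, hz⟩ := Ideal.mem_span_singleton'.1 h1
  refine ⟨n, mem_span_singleton.2 ⟨z, ?_⟩⟩
  rw [hxa n, hxa (n + 1), ← hz, mul_smul]

/-- Over a right perfect ring, every nonempty set of elements of a left module contains an element
that generates a minimal cyclic submodule. -/
theorem IsRightPerfect.exists_minimal (hR : IsRightPerfect R) (S : Set M) (hS : S.Nonempty) :
    ∃ a ∈ S, ∀ b ∈ S, b ∈ span R {a} → a ∈ span R {b} := by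
  by_contra! H
  obtain ⟨a₀, h₀⟩ := hS
  choose f hfS hf hf' using H
  obtain ⟨x, hx⟩ : ∃ x : ℕ → S, ∀ n, (x (n + 1) : M) = f (x n) (x n).2 :=
    ⟨fun n => Nat.rec ⟨a₀, h₀⟩ (fun _ y => ⟨f y y.2, hfS y y.2⟩) n, fun _ => rfl⟩
  obtain ⟨n, hn⟩ := hR.exists_mem_span_succ (fun n => (x n : M)) fun n => by
    rw [hx]
    exact hf _ (x n).2
  rw [hx] at hn
  exact hf' _ (x n).2 hn

/-- The finitely generated submodules contained in `N` satisfy the descending chain condition. -/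
def FGChainCondition (N : Submodule R M) : Prop :=
  ∀ s : ℕ → Submodule R M, Antitone s → (∀ n, (s n).FG) → s 0 ≤ N → ∃ n, s n ≤ s (n + 1)

/-- Inductive step for `FGChainCondition.sup_span`: the generator outside `N` changes only by an
element of `P`, and keeps its minimality, so the step can be iterated along a chain. -/
theorem IsRightPerfect.exists_eq_span_sup (hR : IsRightPerfect R) {N P S : Submodule R M} {x : M}
    (hx : x ∉ N) (hmin : ∀ b, b ∉ N → b ∈ span R {x} → x ∈ span R {b}) (hP : P ≤ N)
    (hS : S.FG) (hSP : S ≤ span R {x} ⊔ P) (hSN : ¬ S ≤ N) :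
    ∃ (x' : M) (P' : Submodule R M), x' ∉ N ∧
      (∀ b, b ∉ N → b ∈ span R {x'} → x' ∈ span R {b}) ∧ P'.FG ∧ P' ≤ P ∧ x' - x ∈ P ∧
      S = span R {x'} ⊔ P' := by
  obtain ⟨y₀, hy₀S, hy₀N⟩ := SetLike.not_le_iff_exists.1 hSN
  obtain ⟨y, ⟨hyS, hyN⟩, hymin⟩ :=
    hR.exists_minimal {y | y ∈ S ∧ y ∉ N} ⟨y₀, hy₀S, hy₀N⟩
  have hdec : ∀ m ∈ S, ∃ r : R, ∃ p ∈ P, r • x + p = m := fun m hm => by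
    obtain ⟨u, hu, p, hp, h⟩ := Submodule.mem_sup.1 (hSP hm)
    obtain ⟨r, rfl⟩ := mem_span_singleton.1 hu
    exact ⟨r, p, hp, h⟩
  obtain ⟨r, p, hp, hrp⟩ := hdec y hyS
  have hrx : r • x ∉ N := fun h => hyN (hrp ▸ N.add_mem h (hP hp))
  -- Minimality of `x` undoes `r`: `r' • r • x = x`. Hence `r' • y` lies in `S` and is congruent to
  -- `x` modulo `P`.
  obtain ⟨r', hr'⟩ := mem_span_singleton.1
    (hmin _ hrx (mem_span_singleton.2 ⟨r, rfl⟩))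
  have hdiff : r' • y - x ∈ P := by
    have : r' • y - x = r' • p := by
      rw [← hrp, smul_add, hr', add_sub_cancel_left]
    rw [this]
    exact P.smul_mem _ hp
  have hxS : r' • y ∈ S := S.smul_mem _ hyS
  have hxN : r' • y ∉ N := fun h => hx <| by
    have := N.sub_mem h (hP hdiff)
    rwa [sub_sub_cancel] at this
  have hred : ∀ m ∈ S, ∃ c : R, m - c • r' • y ∈ P := fun m hm => by
    obtain ⟨c, q, hq, rfl⟩ := hdec m hm
    refine ⟨c, ?_⟩
    have : c • x + q - c • r' • y = q - c • (r' • y - x) := by rw [smul_sub]; abel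
    rw [this]
    exact P.sub_mem hq (P.smul_mem _ hdiff)
  obtain ⟨t, rfl⟩ := hS
  choose! c hc using hred
  refine ⟨r' • y, span R ((fun m => m - c m • r' • y) '' t), hxN, ?_,
    fg_span (t.finite_toSet.image _), ?_, hdiff, le_antisymm ?_ (sup_le ?_ ?_)⟩
  · intro b hbN hb
    have hby : b ∈ span R {y} := by
      obtain ⟨d, rfl⟩ := mem_span_singleton.1 hb
      exact mem_span_singleton.2 ⟨d * r', mul_smul _ _ _⟩
    have hbS : b ∈ span R (t : Set M) := by
      obtain ⟨d, rfl⟩ := mem_span_singleton.1 hby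
      exact smul_mem _ _ hyS
    exact smul_mem _ _ (hymin b ⟨hbS, hbN⟩ hby)
  · rw [span_le]
    rintro _ ⟨m, hm, rfl⟩
    exact hc m (subset_span hm)
  · rw [span_le]
    intro m hm
    rw [← add_sub_cancel (c m • r' • y) m]
    exact add_mem (mem_sup_left (smul_mem _ _ (mem_span_singleton_self _)))
      (mem_sup_right (subset_span ⟨m, hm, rfl⟩))
  · rwa [span_singleton_le_iff_mem]
  · rw [span_le]
    rintro _ ⟨m, hm, rfl⟩
    exact sub_mem (subset_span hm) (smul_mem _ _ hxS)

/-- If no term lies in `N`, write `s i = R xᵢ + Pᵢ` with the `Pᵢ ≤ N` decreasing and `xᵢ₊₁ - xᵢ ∈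
Pᵢ`. Once `Pₙ ≤ Pₙ₊₁`, also `xₙ ∈ s (n + 1)`. -/
theorem FGChainCondition.sup_span (hR : IsRightPerfect R) {N : Submodule R M}
    (hN : FGChainCondition N) {a : M} (ha : a ∉ N)
    (hmin : ∀ b, b ∉ N → b ∈ span R {a} → a ∈ span R {b}) :
    FGChainCondition (span R {a} ⊔ N) := by
  intro s hs hfg h0
  by_cases hk : ∃ k, s k ≤ N
  · obtain ⟨k, hk⟩ := hk
    obtain ⟨n, hn⟩ := hN (fun n => s (n + k)) (fun i j h => hs (by omega))
      (fun n => hfg _) (by simpa using hk)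
    exact ⟨n + k, by rwa [show n + k + 1 = n + 1 + k by omega]⟩
  push Not at hk
  let I : ℕ → M × Submodule R M → Prop := fun i q => q.1 ∉ N ∧
    (∀ b, b ∉ N → b ∈ span R {q.1} → q.1 ∈ span R {b}) ∧ q.2.FG ∧ q.2 ≤ N ∧
    s i = span R {q.1} ⊔ q.2
  have hstep : ∀ i, ∀ q : {q // I i q}, ∃ q' : {q // I (i + 1) q},
      q'.1.2 ≤ q.1.2 ∧ q'.1.1 - q.1.1 ∈ q.1.2 := by
    rintro i ⟨q, h1, h2, h3, h4, h5⟩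
    obtain ⟨x, P, g1, g2, g3, g4, g5, g6⟩ := hR.exists_eq_span_sup h1 h2 h4 (hfg (i + 1))
      (h5 ▸ hs i.le_succ) (hk _)
    exact ⟨⟨(x, P), g1, g2, g3, g4.trans h4, g6⟩, g4, g5⟩
  choose next hnext hnext' using hstep
  obtain ⟨x, P, g1, g2, g3, g4, g5, g6⟩ :=
    hR.exists_eq_span_sup ha hmin le_rfl (hfg 0) h0 (hk 0)
  let q : ∀ i, {q // I i q} := fun i => Nat.rec ⟨(x, P), g1, g2, g3, g4, g6⟩ next i
  have hq : ∀ i, (q (i + 1)).1.2 ≤ (q i).1.2 := fun i => hnext i (q i)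
  have hq' : ∀ i, (q (i + 1)).1.1 - (q i).1.1 ∈ (q i).1.2 := fun i => hnext' i (q i)
  obtain ⟨n, hn⟩ := hN (fun i => (q i).1.2) (antitone_nat_of_succ_le hq)
    (fun i => (q i).2.2.2.1) (q 0).2.2.2.2.1
  refine ⟨n, ?_⟩
  rw [(q n).2.2.2.2.2, (q (n + 1)).2.2.2.2.2]
  refine sup_le ?_ (hn.trans le_sup_right)
  rw [span_singleton_le_iff_mem, ← sub_sub_cancel (q (n + 1)).1.1 (q n).1.1]
  exact sub_mem (mem_sup_left (mem_span_singleton_self _)) (mem_sup_right (hn (hq' n)))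

/-- Björk's theorem: over a right perfect ring, every left module satisfies the descending chain
condition on finitely generated submodules. -/
theorem IsRightPerfect.fgChainCondition (hR : IsRightPerfect R) (N : Submodule R M) :
    FGChainCondition N := by
  -- Finitely generated submodules are compact, so `s 0` already lies in one member of the chain
  -- `c`.
  obtain ⟨m, hm⟩ := zorn_le₀ {N : Submodule R M | FGChainCondition N} fun c hc hchain => by
    rcases c.eq_empty_or_nonempty with rfl | hne
    · exact ⟨⊥, fun s hs _ h0 => ⟨0, ((h0.trans bot_le))⟩, by simp⟩
    · refine ⟨sSup c, fun s hs hfg h0 => ?_, fun z hz => le_sSup hz⟩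
      obtain ⟨z, hz, hsz⟩ := (CompleteLattice.isCompactElement_iff_le_of_directed_sSup_le _ _).1
        ((Submodule.fg_iff_compact _).1 (hfg 0)) c hne hchain.directedOn h0
      exact hc hz s hs hfg hsz
  have htop : m = ⊤ := by
    by_contra hne
    obtain ⟨a₀, -, ha₀⟩ := SetLike.exists_of_lt (lt_top_iff_ne_top.2 hne)
    obtain ⟨a, ha, hmin⟩ := hR.exists_minimal {y | y ∉ m} ⟨a₀, ha₀⟩
    have := hm.2 (FGChainCondition.sup_span hR hm.1 ha hmin) le_sup_right
    exact ha (this (mem_sup_left (mem_span_singleton_self a)))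
  exact fun s hs hfg _ => hm.1 s hs hfg (htop ▸ le_top)

/-- Square matrices over a right perfect ring are strongly `π`-regular. -/
theorem IsRightPerfect.exists_pow_eq_mul_pow_succ (hR : IsRightPerfect R) {ι : Type*} [Fintype ι]
    [DecidableEq ι] (G : Matrix ι ι R) : ∃ (n : ℕ) (Z : Matrix ι ι R), G ^ n = Z * G ^ (n + 1) := by
  obtain ⟨n, hn⟩ := hR.fgChainCondition (⊤ : Submodule R (ι → R))
    (fun k => LinearMap.range (G ^ k).vecMulLinear)
    (antitone_nat_of_succ_le fun k => by
      rintro _ ⟨x, rfl⟩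
      exact ⟨Matrix.vecMul x G, by simp [Matrix.vecMul_vecMul, pow_succ']⟩)
    (fun k => by
      rw [LinearMap.range_eq_map]
      exact Submodule.FG.map _ Module.Finite.fg_top) le_top
  -- Each row of `G ^ n` lies in the row space of `G ^ (n + 1)`; the coefficients are the rows of
  -- `Z`.
  choose z hz using fun i => hn ⟨Pi.single i 1, rfl⟩
  refine ⟨n, Matrix.of z, ?_⟩
  ext i j
  have := congrFun (hz i) j
  rw [Matrix.vecMulLinear_apply, Matrix.vecMulLinear_apply, Matrix.single_one_vecMul] at this
  exact this.symm

theorem IsRightPerfect.eq_zero_of_matrix_chain (hR : IsRightPerfect R) {ι : Type*} [Fintype ι]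
    (G : Matrix ι ι R) (v : ℕ → ι → M) (hv : ∀ k i, ∑ j, G i j • v (k + 1) j = v k i)
    (h0 : v 0 = 0) : v 1 = 0 := by
  classical
  have hpow : ∀ m k i, ∑ j, (G ^ m) i j • v (k + m) j = v k i := by
    intro m
    induction m with
    | zero => intro k i; simp [Matrix.one_apply]
    | succ m ih =>
      intro k i
      simp only [pow_succ, Matrix.mul_apply, Finset.sum_smul, mul_smul]
      rw [Finset.sum_comm, ← ih k i]
      refine Finset.sum_congr rfl fun l _ => ?_
      rw [← Finset.smul_sum, ← add_assoc, hv]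
  obtain ⟨n, Z, hZ⟩ := hR.exists_pow_eq_mul_pow_succ G
  ext i
  rw [← hpow n 1 i, hZ]
  simp only [Matrix.mul_apply, Finset.sum_smul, mul_smul]
  rw [Finset.sum_comm]
  refine Finset.sum_eq_zero fun l _ => ?_
  have := hpow (n + 1) 0 l
  rw [zero_add, add_comm n 1] at this
  rw [← Finset.smul_sum, add_comm n 1, this, h0]
  simp

end Perfect

namespace BialgebraMaps

/-! ### Finite-dimensional coideals and their coefficient matrices. -/

section Coideals

theorem range_rTensor_subtype_mono {K A : Type*} [Field K] [AddCommGroup A]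
    [Module K A] {X Y : Submodule K A} (h : X ≤ Y) :
    LinearMap.range (X.subtype.rTensor A) ≤ LinearMap.range (Y.subtype.rTensor A) := by
  rintro _ ⟨z, rfl⟩
  refine ⟨(Submodule.inclusion h).rTensor A z, ?_⟩
  rw [← LinearMap.comp_apply, ← LinearMap.rTensor_comp, Submodule.subtype_comp_inclusion]

variable {K A : Type*} [Field K] [AddCommGroup A] [Module K A] [Coalgebra K A]

/-- Every element of a coalgebra over a field lies in a finite-dimensional left coideal. -/
theorem exists_left_coideal (b : A) : ∃ (s : Finset (Module.Basis.ofVectorSpaceIndex K A))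
    (c : s → A) (g : s → s → A), b ∈ Submodule.span K (Set.range c) ∧
      ∀ i, Coalgebra.comul (R := K) (c i) = ∑ j, g i j ⊗ₜ[K] c j := by
  classical
  let e := Module.Basis.ofVectorSpace K A
  obtain ⟨c, hc⟩ := TensorProduct.eq_repr_basis_left e (Coalgebra.comul (R := K) b)
  rw [Finsupp.sum, ← Finset.sum_coe_sort c.support] at hc
  -- With `Δ b = ∑ eᵢ ⊗ cᵢ`, the counit gives `b = ∑ ε(eᵢ) cᵢ`, and the `i`-th coordinate of
  -- coassociativity in the first leg gives `Δ cᵢ`. The `cᵢ` need not be independent.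
  refine ⟨c.support, fun i => c i, fun i j =>
    TensorProduct.lid K A ((e.coord i).rTensor A (Coalgebra.comul (e j))), ?_, fun i => ?_⟩
  · have h := congrArg (TensorProduct.lid K A) (Coalgebra.rTensor_counit_comul (R := K) b)
    rw [← hc] at h
    simp only [map_sum, LinearMap.rTensor_tmul, TensorProduct.lid_tmul, one_smul] at h
    rw [← h]
    exact Submodule.sum_mem _ fun i _ => Submodule.smul_mem _ _ (Submodule.subset_span ⟨i, rfl⟩)
  · have key : ∀ (w : A ⊗[K] A) (x : A), TensorProduct.lid K (A ⊗[K] A)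
        ((e.coord i).rTensor (A ⊗[K] A) (TensorProduct.assoc K A A A (w ⊗ₜ x))) =
          TensorProduct.lid K A ((e.coord i).rTensor A w) ⊗ₜ x := by
      intro w x
      induction w with
      | zero => simp
      | tmul p q => simp [TensorProduct.smul_tmul']
      | add u v hu hv => simp only [TensorProduct.add_tmul, map_add, hu, hv]
    have h := congrArg (fun z => TensorProduct.lid K (A ⊗[K] A)
        ((e.coord i).rTensor (A ⊗[K] A) z)) (Coalgebra.coassoc_apply (R := K) b)
    rw [← hc] at h
    simp only [map_sum, LinearMap.rTensor_tmul, key, LinearMap.lTensor_tmul,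
      TensorProduct.lid_tmul, Module.Basis.coord_apply, Module.Basis.repr_self] at h
    rw [h, Finset.sum_eq_single i]
    · simp
    · intro j _ hj
      rw [Finsupp.single_eq_of_ne fun h => hj (Subtype.ext h.symm), zero_smul]
    · simp

/-- A subspace `X` of a coalgebra `A` with `Δ X ⊆ X ⊗ A`. -/
def IsRightCoideal (X : Submodule K A) : Prop :=
  ∀ x ∈ X, Coalgebra.comul (R := K) x ∈ LinearMap.range (X.subtype.rTensor A)

theorem IsRightCoideal.sup {X Y : Submodule K A} (hX : IsRightCoideal X) (hY : IsRightCoideal Y) :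
    IsRightCoideal (X ⊔ Y) := by
  intro z hz
  obtain ⟨x, hx, y, hy, rfl⟩ := Submodule.mem_sup.1 hz
  rw [map_add]
  exact add_mem (range_rTensor_subtype_mono le_sup_left (hX x hx))
    (range_rTensor_subtype_mono le_sup_right (hY y hy))

/-- Every element of a coalgebra over a field lies in a finite-dimensional right coideal. -/
theorem exists_right_coideal (b : A) :
    ∃ X : Submodule K A, X.FG ∧ IsRightCoideal X ∧ b ∈ X := by
  classical
  let e := Module.Basis.ofVectorSpace K A
  obtain ⟨c, hc⟩ := TensorProduct.eq_repr_basis_right e (Coalgebra.comul (R := K) b)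
  rw [Finsupp.sum] at hc
  refine ⟨Submodule.span K (c '' c.support),
    Submodule.fg_span (c.support.finite_toSet.image c), ?_, ?_⟩
  · have key : ∀ (i) (w : A ⊗[K] A) (x : A), TensorProduct.rid K (A ⊗[K] A)
        ((e.coord i).lTensor (A ⊗[K] A) ((TensorProduct.assoc K A A A).symm (x ⊗ₜ w))) =
          x ⊗ₜ TensorProduct.rid K A ((e.coord i).lTensor A w) := by
      intro i w x
      induction w with
      | zero => simp
      | tmul p q => simp
      | add u v hu hv => simp only [TensorProduct.tmul_add, map_add, hu, hv]
    suffices h : Submodule.span K (c '' c.support) ≤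
        (LinearMap.range ((Submodule.span K (c '' c.support)).subtype.rTensor A)).comap
          Coalgebra.comul from fun x hx => h hx
    rw [Submodule.span_le]
    rintro _ ⟨i, hi, rfl⟩
    have h := congrArg (fun z => TensorProduct.rid K (A ⊗[K] A)
        ((e.coord i).lTensor (A ⊗[K] A) z)) (Coalgebra.coassoc_symm_apply (R := K) b)
    rw [← hc] at h
    simp only [map_sum, LinearMap.rTensor_tmul, key, LinearMap.lTensor_tmul,
      TensorProduct.rid_tmul, Module.Basis.coord_apply, Module.Basis.repr_self] at h
    symm at h
    rw [Finset.sum_eq_single_of_mem i hi fun j _ hj => by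
      rw [Finsupp.single_eq_of_ne (Ne.symm hj), zero_smul], Finsupp.single_eq_same, one_smul] at h
    rw [SetLike.mem_coe, Submodule.mem_comap, h]
    exact Submodule.sum_mem _ fun j hj =>
      ⟨⟨c j, Submodule.subset_span ⟨j, hj, rfl⟩⟩ ⊗ₜ _, rfl⟩
  · have h := congrArg (TensorProduct.rid K A) (Coalgebra.lTensor_counit_comul (R := K) b)
    rw [← hc] at h
    simp only [map_sum, LinearMap.lTensor_tmul, TensorProduct.rid_tmul, one_smul] at h
    rw [← h]
    exact Submodule.sum_mem _ fun i hi => Submodule.smul_mem _ _ (Submodule.subset_span ⟨i, hi, rfl⟩)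

theorem exists_right_coideal_tensor (t : A ⊗[K] A) :
    ∃ X : Submodule K A, X.FG ∧ IsRightCoideal X ∧ t ∈ LinearMap.range (X.subtype.rTensor A) := by
  induction t with
  | zero => exact ⟨⊥, Submodule.fg_bot, fun x hx => by
      rw [(Submodule.mem_bot K).1 hx, map_zero]; exact zero_mem _, zero_mem _⟩
  | tmul p q =>
    obtain ⟨X, h1, h2, h3⟩ := exists_right_coideal (K := K) p
    exact ⟨X, h1, h2, ⟨p, h3⟩ ⊗ₜ q, rfl⟩
  | add u v hu hv =>
    obtain ⟨X, h1, h2, h3⟩ := hu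
    obtain ⟨Y, g1, g2, g3⟩ := hv
    exact ⟨X ⊔ Y, h1.sup g1, h2.sup g2,
      add_mem (range_rTensor_subtype_mono le_sup_left h3)
        (range_rTensor_subtype_mono le_sup_right g3)⟩

/-- Every tensor can be written as `∑ xᵢ ⊗ yᵢ` where the `xᵢ` are a basis of a right coideal. The
functionals `fᵢ` witness the linear independence of the `xᵢ`. -/
theorem exists_right_coideal_basis (t : A ⊗[K] A) :
    ∃ (n : ℕ) (x y : Fin n → A) (f : Fin n → A →ₗ[K] K) (g : Fin n → Fin n → A),
      (∀ i j, f i (x j) = if j = i then 1 else 0) ∧ t = ∑ i, x i ⊗ₜ[K] y i ∧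
      ∀ i, Coalgebra.comul (R := K) (x i) = ∑ j, x j ⊗ₜ[K] g j i := by
  obtain ⟨X, hfg, hX, ht⟩ := exists_right_coideal_tensor t
  have : FiniteDimensional K X := Module.Finite.iff_fg.2 hfg
  let x := Module.finBasis K X
  have hrep : ∀ u ∈ LinearMap.range (X.subtype.rTensor A),
      ∃ y : Fin (Module.finrank K X) → A, u = ∑ i, (x i : A) ⊗ₜ[K] y i := by
    rintro _ ⟨w, rfl⟩
    obtain ⟨y, rfl⟩ := TensorProduct.eq_repr_basis_left x w
    refine ⟨y, ?_⟩
    rw [Finsupp.sum_fintype _ _ (by simp), map_sum]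
    rfl
  obtain ⟨π, hπ⟩ := X.subtype.exists_leftInverse_of_injective X.ker_subtype
  obtain ⟨y, hy⟩ := hrep t ht
  choose g hg using fun i => hrep _ (hX (x i) (x i).2)
  refine ⟨_, fun i => x i, y, fun i => x.coord i ∘ₗ π, fun j i => g i j, fun i j => ?_, hy, hg⟩
  have : π (x j : A) = x j := LinearMap.congr_fun hπ (x j)
  simp [this, Finsupp.single_apply]

end Coideals

/-! ### Surjectivity of `i_B`. -/

section Surjective

variable {K B : Type*} [Field K] [Ring B] [Bialgebra K B]

variable (K B) in
/-- The maps `b ↦ bₖ ⋯ b₂ b₁`, with the last factor `b₁` split off. -/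
noncomputable def revPow : ℕ → B →ₗ[K] B
  | 0 => Algebra.linearMap K B ∘ₗ Coalgebra.counit
  | k + 1 => (LinearMap.mul' K B ∘ₗ (revPow k).rTensor B ∘ₗ
      (TensorProduct.comm K B B).toLinearMap) ∘ₗ Coalgebra.comul

/-- Coassociativity gives `b₁ ⊗ revPow (k + 1) b₂ = (1 ⊗ revPow k b₂) Δ(b₁)`, and modulo `(B ⊗ B)B⁺`
the factor `Δ(b₁)` acts as `ε(b₁)`. -/
theorem lTensor_revPow_succ_comul (k : ℕ) (b : B) :
    (revPow K B (k + 1)).lTensor B (Coalgebra.comul b) - 1 ⊗ₜ[K] revPow K B k b ∈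
      augSubmodule K B := by
  have key : ∀ (w : B ⊗[K] B) (r : B), (LinearMap.mul' K B ∘ₗ (revPow K B k).rTensor B ∘ₗ
      (TensorProduct.comm K B B).toLinearMap).lTensor B (TensorProduct.assoc K B B B (w ⊗ₜ r)) =
        (1 ⊗ₜ revPow K B k r) * w := by
    intro w r
    induction w with
    | zero => simp
    | tmul p q => simp
    | add u v hu hv => simp only [TensorProduct.add_tmul, map_add, hu, hv, mul_add]
  let 𝓡 := Coalgebra.Repr.arbitrary K b
  have h1 : (revPow K B (k + 1)).lTensor B (Coalgebra.comul b) =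
      ∑ i ∈ 𝓡.index, (1 ⊗ₜ revPow K B k (𝓡.right i)) * Coalgebra.comul (𝓡.left i) := by
    rw [revPow, LinearMap.lTensor_comp, LinearMap.comp_apply, ← Coalgebra.coassoc_apply, ← 𝓡.eq]
    simp only [map_sum, LinearMap.rTensor_tmul, key]
  have h2 : (1 : B) ⊗ₜ[K] revPow K B k b = ∑ i ∈ 𝓡.index, (1 ⊗ₜ revPow K B k (𝓡.right i)) *
      algebraMap K (B ⊗[K] B) (Coalgebra.counit (𝓡.left i)) := by
    have h := congrArg (TensorProduct.lid K B) (Coalgebra.sum_counit_tmul_eq (R := K) 𝓡)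
    simp only [map_sum, TensorProduct.lid_tmul, one_smul] at h
    conv_lhs => rw [← h]
    simp only [map_sum, map_smul, TensorProduct.tmul_sum, TensorProduct.tmul_smul,
      ← Algebra.commutes, ← Algebra.smul_def]
  rw [h1, h2, ← Finset.sum_sub_distrib]
  refine Submodule.sum_mem _ fun i _ => ?_
  refine Submodule.subset_span ⟨1 ⊗ₜ revPow K B k (𝓡.right i),
    𝓡.left i - algebraMap K B (Coalgebra.counit (𝓡.left i)), by simp, ?_⟩
  rw [map_sub, Bialgebra.comul_algebraMap, mul_sub]

theorem smul_mem_augSubmodule (b : B) {z : B ⊗[K] B} (hz : z ∈ augSubmodule K B) :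
    b • z ∈ augSubmodule K B := by
  induction hz using Submodule.span_induction with
  | mem z hz =>
    obtain ⟨t, c, hc, rfl⟩ := hz
    exact Submodule.subset_span ⟨b • t, c, hc, (smul_mul_assoc b t _).symm⟩
  | zero => simp
  | add u v _ _ hu hv => rw [smul_add]; exact add_mem hu hv
  | smul r u _ hu => rw [smul_comm]; exact Submodule.smul_mem _ r hu

variable (K B) in
/-- The left `B`-submodule `B ⊗ 1 + (B ⊗ B) B⁺` of `B ⊗ B`. -/
noncomputable def rangeSubmodule : Submodule B (B ⊗[K] B) where
  carrier := {z | ∃ a : B, z - a ⊗ₜ 1 ∈ augSubmodule K B}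
  zero_mem' := ⟨0, by simp⟩
  add_mem' := by
    rintro u v ⟨a, ha⟩ ⟨c, hc⟩
    refine ⟨a + c, ?_⟩
    rw [TensorProduct.add_tmul, add_sub_add_comm]
    exact add_mem ha hc
  smul_mem' := by
    rintro b u ⟨a, ha⟩
    refine ⟨b * a, ?_⟩
    have := smul_mem_augSubmodule b ha
    rwa [smul_sub, TensorProduct.smul_tmul', smul_eq_mul] at this

theorem one_tmul_mem_rangeSubmodule (hB : IsRightPerfect B) (b : B) :
    1 ⊗ₜ b ∈ rangeSubmodule K B := by
  obtain ⟨s, c, g, hb, hc⟩ := exists_left_coideal (K := K) b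
  have hv := hB.eq_zero_of_matrix_chain (Matrix.of g)
    (fun k j => (rangeSubmodule K B).mkQ (1 ⊗ₜ revPow K B k (c j)))
    (fun k i => by
      have h := lTensor_revPow_succ_comul (K := K) k (c i)
      rw [hc] at h
      simp only [map_sum, LinearMap.lTensor_tmul] at h
      simp only [← map_smul, ← map_sum]
      rw [← sub_eq_zero, ← map_sub, Submodule.mkQ_apply, Submodule.Quotient.mk_eq_zero]
      refine ⟨0, ?_⟩
      simpa [TensorProduct.smul_tmul'] using h)
    -- At `k = 0` the vector is `1 ⊗ ε(c j) = ε(c j) ⊗ 1`, which lies in `B ⊗ 1`.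
    (by
      ext j
      refine (Submodule.Quotient.mk_eq_zero _).2
        ⟨algebraMap K B (Coalgebra.counit (c j)), ?_⟩
      simp [revPow, Algebra.algebraMap_eq_smul_one, TensorProduct.smul_tmul])
  have h1 : ∀ a : B, revPow K B 1 a = a := by
    intro a
    let 𝓡 := Coalgebra.Repr.arbitrary K a
    have h := congrArg (TensorProduct.rid K B) (Coalgebra.sum_tmul_counit_eq (R := K) 𝓡)
    simp only [map_sum, TensorProduct.rid_tmul, one_smul] at h
    simp only [revPow, LinearMap.comp_apply, ← 𝓡.eq, map_sum]
    simpa [Algebra.smul_def] using h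
  have hle : Submodule.span K (Set.range c) ≤
      ((rangeSubmodule K B).restrictScalars K).comap (TensorProduct.mk K B B 1) := by
    rw [Submodule.span_le]
    rintro _ ⟨j, rfl⟩
    have := congrFun hv j
    rw [h1] at this
    exact (Submodule.Quotient.mk_eq_zero (rangeSubmodule K B)).1 this
  exact hle hb

theorem iMap_surjective (hB : IsRightPerfect B) : Function.Surjective (iMap K B) := by
  intro z
  obtain ⟨t, rfl⟩ := (augSubmodule K B).mkQ_surjective z
  have ht : t ∈ rangeSubmodule K B := by
    induction t with
    | zero => exact zero_mem _
    | tmul x y =>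
      have := (rangeSubmodule K B).smul_mem x (one_tmul_mem_rangeSubmodule hB y)
      rwa [TensorProduct.smul_tmul', smul_eq_mul, mul_one] at this
    | add u v hu hv => exact add_mem hu hv
  obtain ⟨a, ha⟩ := ht
  exact ⟨a, ((Submodule.Quotient.eq _).2 ha).symm⟩

end Surjective

/-! ### Injectivity of `p_B`. -/

section Injective

variable {K B : Type*} [Field K] [Ring B] [Bialgebra K B]

variable (K B) in
/-- The maps `b ↦ bₖ ⋯ b₂ b₁`, with the first factor `bₖ` split off. -/
noncomputable def revPow' : ℕ → B →ₗ[K] B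
  | 0 => Algebra.linearMap K B ∘ₗ Coalgebra.counit
  | k + 1 => (LinearMap.mul' K B ∘ₗ (revPow' k).lTensor B ∘ₗ
      (TensorProduct.comm K B B).toLinearMap) ∘ₗ Coalgebra.comul

theorem pMap_injective (hB : IsRightPerfect B) : Function.Injective (pMap K B) := by
  rw [← LinearMap.ker_eq_bot, LinearMap.ker_eq_bot']
  rintro ⟨t, ht⟩ hp
  obtain ⟨n, x, y, f, g, hf, rfl, hx⟩ := exists_right_coideal_basis t
  have hcounit : ∀ j, Coalgebra.counit (R := K) (y j) = 0 := by
    intro j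
    have h := congrArg (f j) hp
    simpa [pMap, hf] using h
  -- Comparing coefficients of the independent `x j` in the coinvariance equation.
  have hco : ∀ j, ∑ i, (LinearMap.mulLeft K (g j i)).lTensor B (Coalgebra.comul (y i)) =
      y j ⊗ₜ[K] 1 := by
    intro j
    have key : ∀ (i) (w : B ⊗[K] B), TensorProduct.lid K (B ⊗[K] B) ((f j).rTensor (B ⊗[K] B)
        (TensorProduct.assoc K B B B (TensorProduct.map LinearMap.id (LinearMap.mul' K B)
          (TensorProduct.tensorTensorTensorComm K B B B B (Coalgebra.comul (x i) ⊗ₜ w))))) =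
        (LinearMap.mulLeft K (g j i)).lTensor B w := by
      intro i w
      induction w with
      | zero => simp
      | tmul p q => simp [hx, TensorProduct.sum_tmul, hf]
      | add u v hu hv => simp only [TensorProduct.tmul_add, map_add, hu, hv]
    have h := congrArg (fun z => TensorProduct.lid K (B ⊗[K] B) ((f j).rTensor (B ⊗[K] B)
      (TensorProduct.assoc K B B B z))) (LinearMap.mem_eqLocus.1 ht)
    simp only [diagCoaction, map_sum, LinearMap.comp_apply, TensorProduct.map_tmul,
      LinearEquiv.coe_coe, key] at h
    rw [h]
    simp [hf]
  -- Applying `p ⊗ q ↦ q * revPow' k p` to `hco` gives the recursion; `revPow'` splits off the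
  -- factor next to `g j i`. The start vanishes because `ε(y j) = 0`.
  have hv := hB.eq_zero_of_matrix_chain (Matrix.of g) (fun k j => revPow' K B k (y j))
    (fun k j => by
      have key : ∀ (a : B) (w : B ⊗[K] B), (LinearMap.mul' K B ∘ₗ (revPow' K B k).lTensor B ∘ₗ
          (TensorProduct.comm K B B).toLinearMap) ((LinearMap.mulLeft K a).lTensor B w) =
            a * (LinearMap.mul' K B ∘ₗ (revPow' K B k).lTensor B ∘ₗ
              (TensorProduct.comm K B B).toLinearMap) w := by
        intro a w
        induction w with
        | zero => simp
        | tmul p q => simp [mul_assoc]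
        | add u v hu hv => simp only [map_add, hu, hv, mul_add]
      have h := congrArg (LinearMap.mul' K B ∘ₗ (revPow' K B k).lTensor B ∘ₗ
          (TensorProduct.comm K B B).toLinearMap) (hco j)
      simp only [map_sum, key] at h
      simpa [revPow'] using h)
    (by ext j; simp [revPow', hcounit])
  have h1 : ∀ a : B, revPow' K B 1 a = a := by
    intro a
    let 𝓡 := Coalgebra.Repr.arbitrary K a
    have h := congrArg (TensorProduct.lid K B) (Coalgebra.sum_counit_tmul_eq (R := K) 𝓡)
    simp only [map_sum, TensorProduct.lid_tmul, one_smul] at h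
    simp only [revPow', LinearMap.comp_apply, ← 𝓡.eq, map_sum]
    simpa [Algebra.smul_def, Algebra.commutes] using h
  refine Subtype.ext ?_
  change ∑ i, x i ⊗ₜ[K] y i = 0
  refine Finset.sum_eq_zero fun i _ => ?_
  have := congrFun hv i
  rw [h1] at this
  rw [this, Pi.zero_apply, TensorProduct.tmul_zero]

end Injective

end BialgebraMaps

theorem mainTheorem8 {K B : Type*} [Field K] [Ring B] [Bialgebra K B]
    (hB : IsRightPerfect B) :
    Function.Surjective (BialgebraMaps.iMap K B) ∧ Function.Injective (BialgebraMaps.pMap K B) :=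
  ⟨BialgebraMaps.iMap_surjective hB, BialgebraMaps.pMap_injective hB⟩
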